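/- Let a finite two-player normal-form game be given, with action sets $A^1,A^2$ and payoff functions $r^1,r^2:A^1\times A^2\to\mathbb R$; let $-i$ denote the opponent of player $i$. Let $\pi_0^1,\pi_0^2$ be arbitrary mixed actions (the level-$0$ policies, for instance the uniform ones), let $k\ge 0$, and let one of the two players be designated as the reasoner. For each player $i$ and each level $\ell\in\{0,\dots,k\}$ let $\lambda^{i,\ell}=(\lambda^{i,\ell}_m)_{m=0}^{k}$ be an arbitrary probability vector: the prior belief of the level-$\ell$ player $i$ that the opponent has level $m$. *The level-$k$ (GR2) reasoning game.* Nature first chooses the levels of both players, and each player learns only the own level. Then a reasoning path $a_0,a_1,\dots,a_k$ is built: the players alternate, the last action $a_k$ being chosen by the reasoner, and each action is chosen knowing the path so far. The action $a_0$ and all actions of a level-$0$ player are drawn from the level-$0$ policy of the player who moves; all other actions are chosen freely. If $k\ge1$, the payoff $u^i$ is $r^i$ at the pair of actions $(a_{k-1},a_k)$; if $k=0$, it is the expected value of $r^i$ when the reasoner plays $a_0$ and the opponent the level-$0$ policy. An information set of player $i$ is a pair $(h,\ell)$ of a path $h$ after which $i$ moves and an own level $\ell$ of $i$. A strategy $\pi^i$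 assigns to each information set of $i$ a mixed action, subject to the level-$0$ rule above; $\pi^i_\ell$ is its part for level $\ell$. A belief system $p^i$ assigns to each information set $(h,\ell)$ of $i$ a probability vector $(p^{i}_{m}(h,\ell))_{m=0}^k$ over the levels of the opponent. Let $u^i(\pi^i_\ell,\pi^{-i}_m\mid h)$ be the expected payoff of $i$ when play starts at $h$, $i$ has level $\ell$ and the opponent level $m$, and let $P(h\mid \pi^i_\ell,\pi^{-i}_m)$ be the probability that $h$ is reached then. A *Perfect Bayesian Equilibrium* is a strategy pair $(\pi^i_*)_i$ with a belief pair $(p^i)_i$ such that for each player $i$ and each information set $(h,\ell)$ of $i$ the following holds. 1. (Sequential rationality) For every strategy $\pi^i$ of player $i$, $$\sum_{m=0}^k w_m\,u^i(\pi^i_{*,\ell},\pi^{-i}_{*,m}\mid h)\ \ge\ \sum_{m=0}^k w_m\,u^i(\pi^i_{\ell},\pi^{-i}_{*,m}\mid h),$$ where the weights $w_m$ are the beliefs $p^i_m(h,\ell)$. 2. (Consistency) $p^i_m(h,\ell)=0$ whenever $\lambda^{i,\ell}_m=0$, and, if $\sum_n\lambda^{i,\ell}_n P(h\mid\pi^i_{*,\ell},\pi^{-i}_{*,n})>0$,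 $$p^i_m(h,\ell)=\frac{\lambda^{i,\ell}_m\,P(h\mid\pi^i_{*,\ell},\pi^{-i}_{*,m})}{\sum_{n=0}^k\lambda^{i,\ell}_n\,P(h\mid\pi^i_{*,\ell},\pi^{-i}_{*,n})}\qquad(0\le m\le k).$$ **Theorem.** The level-$k$ reasoning game is a finite extensive-form game with perfect recall, and for all priors $\lambda^{i,\ell}$ it has a Perfect Bayesian Equilibrium. For all priors it also has a Perfect Bayesian Equilibrium in the variant of the definition in which the weights in sequential rationality are $w_m=\lambda^{i,\ell}_m\,p^i_m(h,\ell)$. -/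

import Mathlib

/-! ## Finite extensive forms, initial nodes chosen by nature, perfect recall -/

/-- The data of an extensive form with set of players `P`. As in Kreps and Wilson, nature moves
only at the beginning, by choosing one of the initial nodes. -/
structure ExtensiveForm (P : Type) where
  /-- all nodes, terminal ones included -/
  Node : Type*
  /-- the nodes among which nature chooses -/
  Initial : Set Node
  /-- the information sets (at which some player has to move) -/
  Info : Type*
  /-- the actions available at an information set -/
  Act : Info → Type*
  /-- the player who moves at an information set -/
  player : Info → P
  /-- the information set that a node belongs to; `none` at a terminal node -/
  info : Node → Option Info
  /-- the node that follows a node when an action is taken there -/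
  next : (x : Node) → (I : Info) → info x = some I → Act I → Node

namespace ExtensiveForm

/-- `F.Play w l x`: the sequence `l` of decisions (information set and action taken there) leads
from the initial node `w` to the node `x`. -/
inductive Play {P : Type} (F : ExtensiveForm P) (w : F.Node) :
    List (Σ I : F.Info, F.Act I) → F.Node → Prop
  | start (hw : w ∈ F.Initial) : Play F w [] w
  | move {l : List (Σ I : F.Info, F.Act I)} {x : F.Node} (hx : Play F w l x)
      (I : F.Info) (hI : F.info x = some I) (a : F.Act I) :
      Play F w (l ++ [⟨I, a⟩]) (F.next x I hI a)

/-- The nodes form a finite union of finite rooted trees with finitely many actions at each node,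
one tree for each initial node: every node is reached by exactly one play. -/
def IsFiniteForest {P : Type} (F : ExtensiveForm P) : Prop :=
  Finite F.Node ∧ (∀ I, Finite (F.Act I)) ∧
    ∀ x : F.Node, ∃! p : F.Node × List (Σ I : F.Info, F.Act I), F.Play p.1 p.2 x

open Classical in
/-- The record of player `i` along a list of decisions: the information sets at which `i` moved,
with the actions that `i` took there. -/
noncomputable def record {P : Type} (F : ExtensiveForm P) (i : P)
    (l : List (Σ I : F.Info, F.Act I)) : List (Σ I : F.Info, F.Act I) :=
  l.filter fun d => F.player d.1 = i

/-- Perfect recall: at any two nodes of the same information set, the player who moves there has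
the same record of own past information sets and actions. -/
def PerfectRecall {P : Type} (F : ExtensiveForm P) : Prop :=
  ∀ (I : F.Info) (x y : F.Node), F.info x = some I → F.info y = some I →
    ∀ (w v : F.Node) (l m : List (Σ I : F.Info, F.Act I)), F.Play w l x → F.Play v m y →
      F.record (F.player I) l = F.record (F.player I) m

end ExtensiveForm

/-! ## The level-`k` reasoning game over a two-player normal-form game

The players are the two booleans, `!i` being the opponent of `i`. The action sets of the normal-form
game are `A i`, its payoff functions are `r i : (∀ j, A j) → ℝ`. The player `root` carries out the
reasoning: a reasoning path `a_0, a_1, …, a_k` ends with the action `a_k` of `root`, which answers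
the action `a_{k-1}` of the opponent, which answers the action `a_{k-2}` of `root`, and so on. -/

namespace GR2

/-- The player who chooses the reasoning action `a_t`. -/
def mover (root : Bool) (k t : ℕ) : Bool :=
  if Even (k + t) then root else !root

/-- Reasoning paths `a_0, …, a_{t-1}`. -/
def Path (A : Bool → Type*) (root : Bool) (k : ℕ) : ℕ → Type _
  | 0 => PUnit
  | t + 1 => Path A root k t × A (mover root k t)

/-- A node of the reasoning game: the levels of the two players and the reasoning path so far. -/
structure Node (A : Bool → Type*) (root : Bool) (k : ℕ) where
  levels : Bool → Fin (k + 1)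
  stage : ℕ
  stage_le : stage ≤ k + 1
  path : Path A root k stage

/-- An information set of the reasoning game: the player who moves at this stage knows the
reasoning path and the own level, but not the level of the opponent. -/
structure InfoSet (A : Bool → Type*) (root : Bool) (k : ℕ) where
  stage : ℕ
  stage_le : stage ≤ k
  path : Path A root k stage
  level : Fin (k + 1)

namespace InfoSet

/-- The player who moves at an information set. -/
def player {A : Bool → Type*} {root : Bool} {k : ℕ} (I : InfoSet A root k) : Bool :=
  mover root k I.stage

/-- The actions available at an information set. -/
abbrev Act {A : Bool → Type*} {root : Bool} {k : ℕ} (I : InfoSet A root k) : Type _ :=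
  A (mover root k I.stage)

end InfoSet

/-- The extensive form of the reasoning game: nature chooses the two levels, after which the players
alternate in choosing `a_0, …, a_k`. -/
def form (A : Bool → Type*) (root : Bool) (k : ℕ) : ExtensiveForm Bool where
  Node := Node A root k
  Initial := {x | x.stage = 0}
  Info := InfoSet A root k
  Act := InfoSet.Act
  player := InfoSet.player
  info x := if h : x.stage ≤ k then
      some ⟨x.stage, h, x.path, x.levels (mover root k x.stage)⟩
    else none
  next x I hI a :=
    have hx : x.stage ≤ k := by
      by_contra h
      simp [h] at hI
    have hs : I.stage = x.stage := by
      rw [dif_pos hx] at hI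
      exact (congrArg InfoSet.stage (Option.some.inj hI)).symm
    ⟨x.levels, x.stage + 1, Nat.succ_le_succ hx, (x.path, hs ▸ a)⟩

/-- Strategy profiles: a mixed action at each information set. The strategy `π^i` of player `i` is
the restriction to the information sets of player `i`, and the strategy `π^i_ℓ` of the level-`ℓ`
player `i` is the restriction to those of level `ℓ`. -/
abbrev Profile (A : Bool → Type*) [∀ i, Fintype (A i)] (root : Bool) (k : ℕ) : Type _ :=
  ∀ I : InfoSet A root k, stdSimplex ℝ I.Act

/-- Belief systems: at each information set, a distribution over the levels of the opponent of the
player who moves there. -/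
abbrev Beliefs (A : Bool → Type*) (root : Bool) (k : ℕ) : Type _ :=
  InfoSet A root k → stdSimplex ℝ (Fin (k + 1))

section Game

variable {A : Bool → Type*} [∀ i, Fintype (A i)] {root : Bool} {k : ℕ}

/-- The action profile after a reasoning path that starts from the action profile `b`: the latest
action of each player. After at least two reasoning actions `b` has no influence on it. -/
def lastActions (b : ∀ j, A j) : (t : ℕ) → Path A root k t → ∀ j, A j
  | 0, _ => b
  | t + 1, h => Function.update (lastActions b t h.1) (mover root k t) h.2

/-- Payoff of player `i` on a complete reasoning path: for `k ≥ 1` the normal-form payoff at the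
pair of actions `a_{k-1}`, `a_k`. For `k = 0` there is no action `a_{k-1}`, and it is the expected
payoff against an opponent who follows the level-`0` policy `π₀`. -/
noncomputable def payoff (r : Bool → (∀ j, A j) → ℝ) (π₀ : ∀ i, stdSimplex ℝ (A i)) (i : Bool)
    (h : Path A root k (k + 1)) : ℝ :=
  ∑ b : (∀ j, A j), (∏ j, π₀ j (b j)) * r i (lastActions b (k + 1) h)

/-- Expected value of the function `u` of the complete reasoning path when, from the path `h` on,
the profile `σ` is played by players of the levels `θ`; `n` reasoning actions are still to come. -/
noncomputable def value (u : Path A root k (k + 1) → ℝ) (σ : Profile A root k)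
    (θ : Bool → Fin (k + 1)) :
    (n t : ℕ) → t + n = k + 1 → Path A root k t → ℝ
  | 0, _, e, h => u (e ▸ h)
  | n + 1, t, e, h =>
      ∑ a : A (mover root k t),
        σ ⟨t, by omega, h, θ (mover root k t)⟩ a * value u σ θ n (t + 1) (by omega) (h, a)

/-- Probability that a reasoning path is reached when the profile `σ` is played by players of the
levels `θ`. -/
noncomputable def reach (σ : Profile A root k) (θ : Bool → Fin (k + 1)) :
    (t : ℕ) → t ≤ k + 1 → Path A root k t → ℝ
  | 0, _, _ => 1
  | t + 1, e, h =>
      reach σ θ t (by omega) h.1 * σ ⟨t, by omega, h.1, θ (mover root k t)⟩ h.2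

/-- The levels of the two players, given an information set and the level of the opponent of the
player who moves there. -/
def levelsAt (I : InfoSet A root k) (m : Fin (k + 1)) : Bool → Fin (k + 1) :=
  fun j => if j = I.player then I.level else m

/-- The payoff `u^i(σ | h)` of the player who moves at `I`, in the game that follows, when the
opponent has level `m`. -/
noncomputable def payoffAt (r : Bool → (∀ j, A j) → ℝ) (π₀ : ∀ i, stdSimplex ℝ (A i))
    (σ : Profile A root k) (I : InfoSet A root k) (m : Fin (k + 1)) : ℝ :=
  value (payoff r π₀ I.player) σ (levelsAt I m) (k + 1 - I.stage) I.stage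
    (by have := I.stage_le; omega) I.path

/-- The profile in which player `i` uses `τ` and the opponent uses `σ`. -/
def deviate (i : Bool) (τ σ : Profile A root k) : Profile A root k :=
  fun I => if I.player = i then τ I else σ I

/-- Level-`0` reasoning is not strategic: the action `a_0`, and every action of a level-`0` player,
is drawn from the level-`0` policy. -/
def RespectsLevelZero (π₀ : ∀ i, stdSimplex ℝ (A i)) (σ : Profile A root k) : Prop :=
  ∀ I : InfoSet A root k, I.stage = 0 ∨ I.level = 0 → σ I = π₀ (mover root k I.stage)

/-- Sequential rationality of `σ` given the beliefs `p`: at each information set, no strategy of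
the player who moves there gives a higher expected payoff than that player's strategy in `σ`. The
expectation over the level `m` of the opponent is taken with the weights `c i ℓ m * p I m`, where
`i` is the player and `ℓ` the own level of the player; `c = 1` is the plain expectation with
respect to the beliefs. -/
def SequentiallyRational (r : Bool → (∀ j, A j) → ℝ) (π₀ : ∀ i, stdSimplex ℝ (A i))
    (c : Bool → Fin (k + 1) → Fin (k + 1) → ℝ) (σ : Profile A root k) (p : Beliefs A root k) :
    Prop :=
  ∀ (I : InfoSet A root k) (τ : Profile A root k), RespectsLevelZero π₀ τ →
    ∑ m, c I.player I.level m * p I m * payoffAt r π₀ (deviate I.player τ σ) I m ≤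
      ∑ m, c I.player I.level m * p I m * payoffAt r π₀ σ I m

/-- The probability that the information set `I` is reached when the opponent of the player who
moves there has level `m`. -/
noncomputable def reachAt (σ : Profile A root k) (I : InfoSet A root k) (m : Fin (k + 1)) : ℝ :=
  reach σ (levelsAt I m) I.stage (I.stage_le.trans (Nat.le_succ k)) I.path

/-- Consistency of the beliefs `p` with the priors `lam` and the profile `σ`: they are given by
Bayes' rule at each information set that the player who moves there reaches with positive
probability, and levels of prior probability zero get belief zero everywhere. -/
def Consistent (lam : Bool → Fin (k + 1) → stdSimplex ℝ (Fin (k + 1)))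
    (σ : Profile A root k) (p : Beliefs A root k) : Prop :=
  ∀ (I : InfoSet A root k) (m : Fin (k + 1)),
    (lam I.player I.level m = 0 → p I m = 0) ∧
    (0 < ∑ n, lam I.player I.level n * reachAt σ I n →
      p I m = lam I.player I.level m * reachAt σ I m /
        ∑ n, lam I.player I.level n * reachAt σ I n)

/-- Perfect Bayesian equilibrium of the reasoning game, where the level-`ℓ` player `i` holds the
prior `lam i ℓ` over the level of the opponent, and `c` are the weights of the expectation in
`SequentiallyRational`. -/
structure IsPBE (r : Bool → (∀ j, A j) → ℝ) (π₀ : ∀ i, stdSimplex ℝ (A i))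
    (lam : Bool → Fin (k + 1) → stdSimplex ℝ (Fin (k + 1)))
    (c : Bool → Fin (k + 1) → Fin (k + 1) → ℝ)
    (σ : Profile A root k) (p : Beliefs A root k) : Prop where
  respectsLevelZero : RespectsLevelZero π₀ σ
  sequentiallyRational : SequentiallyRational r π₀ c σ p
  consistent : Consistent lam σ p

end Game

end GR2

/-!
The reasoning game is a tree by construction: a node determines the levels and the reasoning path,
hence the play that leads to it (`eq_of_play`), and the own decisions along a path depend on the
levels only through the own level (`record_decisions_congr`).

Perfect Bayesian Equilibria exist without any fixed point theorem, because the payoff depends on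
the actions `a_{k-1}` and `a_k` only, so that all earlier actions are cheap talk. In the babbling
profile (`babbling`) all levels imitate the level-`0` policy at these actions. No action before
`a_{k-1}` then reveals anything about a level, and beliefs stay equal to the priors
(`bayes_eq_prior`), also off the path of play. At `a_k` the level of the opponent no longer matters,
and a player of positive level plays a best reply to `a_{k-1}`; at `a_{k-1}` such a player chooses
an action that is optimal against these replies, with the prior as the belief. Both rules ignore
the path before `a_{k-1}`, so that a deviation at the cheap talk stages has no influence on the
opponent's later actions, and a deviation at `a_{k-1}` or `a_k` cannot be profitable
(`value_early_le`, `value_last_le`).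

In sequential rationality the beliefs may be multiplied by any weights `c ≥ 0` that depend on the
player and on both levels only: the weights on the levels of the opponent are `c` times the prior
throughout the cheap talk stages and at `a_{k-1}`, which is all the argument uses. Both variants of
the definition are therefore special cases of `exists_isPBE`.
-/

namespace GR2

open Finset

/-! ### The extensive form -/

section Form

variable {A : Bool → Type*} {root : Bool} {k : ℕ}

instance finite_path [∀ i, Finite (A i)] : ∀ t, Finite (Path A root k t)
  | 0 => inferInstanceAs (Finite PUnit)
  | t + 1 =>
    have := finite_path t
    inferInstanceAs (Finite (Path A root k t × A (mover root k t)))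

instance finite_node [∀ i, Finite (A i)] : Finite (Node A root k) := by
  refine Finite.of_injective
    (β := (Bool → Fin (k + 1)) × (Σ t : Fin (k + 2), Path A root k t))
    (fun x => (x.levels, ⟨⟨x.stage, Nat.lt_succ_of_le x.stage_le⟩, x.path⟩)) ?_
  rintro ⟨θ, t, ht, h⟩ ⟨θ', t', ht', h'⟩ hxy
  simp only [Prod.mk.injEq, Sigma.mk.injEq, Fin.mk.injEq] at hxy
  obtain ⟨rfl, rfl, hh⟩ := hxy
  cases eq_of_heq hh
  rfl

/-- The decisions along the reasoning path `h`, when the players have the levels `θ`. -/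
def decisions (θ : Bool → Fin (k + 1)) :
    (t : ℕ) → t ≤ k + 1 → Path A root k t → List (Σ I : InfoSet A root k, I.Act)
  | 0, _, _ => []
  | t + 1, e, h =>
    decisions θ t (by omega) h.1 ++ [⟨⟨t, by omega, h.1, θ (mover root k t)⟩, h.2⟩]

theorem play_decisions (θ : Bool → Fin (k + 1)) : ∀ (t : ℕ) (e : t ≤ k + 1)
    (h : Path A root k t),
    (form A root k).Play (⟨θ, 0, Nat.zero_le _, PUnit.unit⟩ : Node A root k)
      (decisions θ t e h) (⟨θ, t, e, h⟩ : Node A root k)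
  | 0, _, _ => .start rfl
  | t + 1, e, h => by
    have ht : t ≤ k := by omega
    exact .move (play_decisions θ t (by omega) h.1) ⟨t, ht, h.1, θ (mover root k t)⟩
      (dif_pos ht) h.2

theorem eq_of_play {w x : (form A root k).Node}
    {l : List (Σ I : (form A root k).Info, (form A root k).Act I)}
    (hp : (form A root k).Play w l x) :
    w = (⟨Node.levels x, 0, Nat.zero_le _, PUnit.unit⟩ : Node A root k) ∧
      l = decisions (Node.levels x) (Node.stage x) (Node.stage_le x) (Node.path x) := by
  induction hp with
  | start hw =>
    obtain ⟨θ, t, ht, h⟩ := w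
    cases (show t = 0 from hw)
    exact ⟨rfl, rfl⟩
  | @move l x _ I hI a ih =>
    obtain ⟨θ, t, ht, h⟩ := x
    have htk : t ≤ k := by
      by_contra hc
      simp [form, hc] at hI
    have hI' : (⟨t, htk, h, θ (mover root k t)⟩ : InfoSet A root k) = I := by
      exact Option.some.inj ((dif_pos htk).symm.trans hI)
    subst hI'
    obtain ⟨rfl, rfl⟩ := ih
    exact ⟨rfl, rfl⟩

theorem form_isFiniteForest [∀ i, Finite (A i)] : (form A root k).IsFiniteForest := by
  refine ⟨finite_node, fun I => inferInstanceAs (Finite (A (mover root k I.stage))), ?_⟩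
  rintro ⟨θ, t, ht, h⟩
  refine ⟨(_, _), play_decisions θ t ht h, ?_⟩
  rintro ⟨w, l⟩ hp
  obtain ⟨h1, h2⟩ := eq_of_play hp
  exact Prod.ext h1 h2

theorem record_decisions_congr {θ θ' : Bool → Fin (k + 1)} {i : Bool} (hi : θ i = θ' i) :
    ∀ (t : ℕ) (e : t ≤ k + 1) (h : Path A root k t),
      (form A root k).record i (decisions θ t e h) =
        (form A root k).record i (decisions θ' t e h)
  | 0, _, _ => rfl
  | t + 1, e, h => by
    have happ : ∀ l l' : List (Σ I : InfoSet A root k, I.Act),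
        (form A root k).record i (l ++ l') =
          (form A root k).record i l ++ (form A root k).record i l' :=
      fun _ _ => List.filter_append _ _
    have hlast : ∀ m m' : Fin (k + 1), (mover root k t = i → m = m') →
        (form A root k).record i [⟨(⟨t, by omega, h.1, m⟩ : InfoSet A root k), h.2⟩] =
          (form A root k).record i [⟨(⟨t, by omega, h.1, m'⟩ : InfoSet A root k), h.2⟩] := by
      intro m m' hm
      by_cases hi' : mover root k t = i
      · rw [hm hi']
      · have hnil : ∀ m : Fin (k + 1),
            (form A root k).record i
              [⟨(⟨t, by omega, h.1, m⟩ : InfoSet A root k), h.2⟩] = [] := by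
          refine fun m => List.filter_eq_nil_iff.2 fun d hd hc => ?_
          cases List.mem_singleton.1 hd
          exact hi' (@of_decide_eq_true _ (Classical.propDecidable _) hc)
        exact (hnil m).trans (hnil m').symm
    exact (happ _ _).trans ((congrArg₂ (· ++ ·) (record_decisions_congr hi t (by omega) h.1)
      (hlast _ _ (by rintro rfl; exact hi))).trans (happ _ _).symm)

theorem form_perfectRecall : (form A root k).PerfectRecall := by
  rintro I ⟨θ, t, ht, h⟩ ⟨θ', t', ht', h'⟩ hx hy w v l m hl hm
  obtain ⟨-, rfl⟩ := eq_of_play hl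
  obtain ⟨-, rfl⟩ := eq_of_play hm
  have htk : t ≤ k := by
    by_contra hc
    simp [form, hc] at hx
  have htk' : t' ≤ k := by
    by_contra hc
    simp [form, hc] at hy
  have hx' : (⟨t, htk, h, θ (mover root k t)⟩ : InfoSet A root k) = I := by
    exact Option.some.inj ((dif_pos htk).symm.trans hx)
  have hy' : (⟨t', htk', h', θ' (mover root k t')⟩ : InfoSet A root k) = I := by
    exact Option.some.inj ((dif_pos htk').symm.trans hy)
  subst hx'
  rw [InfoSet.mk.injEq] at hy'
  obtain ⟨rfl, hh, hθ⟩ := hy'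
  cases eq_of_heq hh
  exact record_decisions_congr hθ.symm _ _ _

end Form

/-! ### Mixed actions -/

section Simplex

variable {α : Type*} [Fintype α]

theorem nonempty_of_stdSimplex (x : stdSimplex ℝ α) : Nonempty α := by
  by_contra hα
  rw [not_nonempty_iff] at hα
  simpa using stdSimplex.sum_eq_one x

theorem sum_mul_le (x : stdSimplex ℝ α) {f : α → ℝ} {M : ℝ} (hf : ∀ a, f a ≤ M) :
    ∑ a, x a * f a ≤ M :=
  calc ∑ a, x a * f a ≤ ∑ a, x a * M :=
        sum_le_sum fun a _ => mul_le_mul_of_nonneg_left (hf a) (stdSimplex.zero_le x a)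
    _ = M := by rw [← sum_mul, stdSimplex.sum_eq_one x, one_mul]

open Classical in
/-- The mixed action that plays `a` for sure. -/
noncomputable def pureAction (a : α) : stdSimplex ℝ α :=
  ⟨Pi.single a 1, single_mem_stdSimplex ℝ a⟩

theorem sum_pureAction_mul (a : α) (f : α → ℝ) : ∑ b, pureAction a b * f b = f a := by
  classical
  change ∑ b, (Pi.single a 1 : α → ℝ) b * f b = f a
  simp [Pi.single_apply]

/-- A maximizer of `f`. -/
noncomputable def argmax [Nonempty α] (f : α → ℝ) : α :=
  (Finite.exists_max f).choose

theorem le_argmax [Nonempty α] (f : α → ℝ) (a : α) : f a ≤ f (argmax f) :=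
  (Finite.exists_max f).choose_spec a

end Simplex

variable {A : Bool → Type*} [∀ i, Fintype (A i)] {root : Bool} {k : ℕ}

/-! ### Expected payoffs -/

/-- The levels of the two players when player `i` has level `ℓ` and the opponent level `m`. -/
def levelPair (i : Bool) (ℓ m : Fin (k + 1)) : Bool → Fin (k + 1) :=
  fun j => if j = i then ℓ else m

theorem levelPair_self (i : Bool) (ℓ m : Fin (k + 1)) : levelPair i ℓ m i = ℓ :=
  if_pos rfl

theorem levelPair_of_ne {i j : Bool} (hj : j ≠ i) (ℓ m : Fin (k + 1)) :
    levelPair i ℓ m j = m :=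
  if_neg hj

theorem deviate_of_eq {i : Bool} (τ σ : Profile A root k) {t : ℕ} (e : t ≤ k)
    (h : Path A root k t) (ℓ : Fin (k + 1)) (hI : mover root k t = i) :
    deviate i τ σ ⟨t, e, h, ℓ⟩ = τ ⟨t, e, h, ℓ⟩ :=
  if_pos hI

theorem deviate_of_ne {i : Bool} (τ σ : Profile A root k) {t : ℕ} (e : t ≤ k)
    (h : Path A root k t) (ℓ : Fin (k + 1)) (hI : mover root k t ≠ i) :
    deviate i τ σ ⟨t, e, h, ℓ⟩ = σ ⟨t, e, h, ℓ⟩ :=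
  if_neg hI

theorem deviate_self (i : Bool) (σ : Profile A root k) : deviate i σ σ = σ := by
  funext I
  simp [deviate]

theorem mover_succ_ne (root : Bool) (k t : ℕ) : mover root k (t + 1) ≠ mover root k t := by
  unfold mover
  by_cases h : Even (k + t) <;> simp [← add_assoc, Nat.even_add_one, h]

theorem eq_mover_or (root : Bool) (k t : ℕ) (i : Bool) :
    i = mover root k t ∨ i = mover root k (t + 1) := by
  have := mover_succ_ne root k t
  revert this
  cases i <;> cases mover root k t <;> cases mover root k (t + 1) <;> simp

/-- Payoff of player `i` on a path whose last two actions are `a_t = a'` and `a_{t+1} = a`. The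
average over `b` is vacuous, since both coordinates of `b` are overwritten; it matches the
definition of `payoff`. -/
noncomputable def pairPayoff (r : Bool → (∀ j, A j) → ℝ) (π₀ : ∀ i, stdSimplex ℝ (A i))
    (root : Bool) (k : ℕ) (i : Bool) (t : ℕ) (a' : A (mover root k t))
    (a : A (mover root k (t + 1))) : ℝ :=
  ∑ b : (∀ j, A j), (∏ j, π₀ j (b j)) *
    r i (Function.update (Function.update b (mover root k t) a') (mover root k (t + 1)) a)

theorem payoff_eq_pairPayoff (r : Bool → (∀ j, A j) → ℝ) (π₀ : ∀ i, stdSimplex ℝ (A i))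
    {j : ℕ} (i : Bool) (h : Path A root (j + 1) j) (a' : A (mover root (j + 1) j))
    (a : A (mover root (j + 1) (j + 1))) :
    payoff (k := j + 1) r π₀ i ((h, a'), a) = pairPayoff r π₀ root (j + 1) i j a' a := by
  unfold payoff pairPayoff
  refine sum_congr rfl fun b _ => ?_
  congr 2
  simp only [lastActions]
  have hne := mover_succ_ne root (j + 1) j
  funext l
  rcases eq_mover_or root (j + 1) j l with rfl | rfl
  · rw [Function.update_of_ne hne.symm, Function.update_of_ne hne.symm,
      Function.update_self, Function.update_self]
  · rw [Function.update_self, Function.update_self]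

theorem value_congr (u : Path A root k (k + 1) → ℝ) {σ σ' : Profile A root k}
    {θ : Bool → Fin (k + 1)}
    (hσ : ∀ (t : ℕ) (e : t ≤ k) (h : Path A root k t),
      σ ⟨t, e, h, θ (mover root k t)⟩ = σ' ⟨t, e, h, θ (mover root k t)⟩) :
    ∀ (n t : ℕ) (e : t + n = k + 1) (h : Path A root k t),
      value u σ θ n t e h = value u σ' θ n t e h
  | 0, _, _, _ => rfl
  | n + 1, t, e, h => by
    simp only [value, hσ]
    exact sum_congr rfl fun a _ => congrArg _ (value_congr u hσ n _ _ _)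

/-- If the mixed actions before the stage `j` do not depend on the level of the opponent, then the
opponent's level is not revealed before that stage: the expected payoff, with arbitrary weights on
the levels of the opponent, is an average of the expected payoffs from the stage `j` on. -/
theorem sum_mul_value_le {j : ℕ} (u : Path A root k (k + 1) → ℝ) (ρ : Profile A root k)
    (i : Bool) (ℓ : Fin (k + 1)) (w : Fin (k + 1) → ℝ) (n : ℕ) (ej : j + n = k + 1) (M : ℝ)
    (hρ : ∀ (t : ℕ) (e : t ≤ k) (h : Path A root k t) (m : Fin (k + 1)), t < j →
      ρ ⟨t, e, h, levelPair i ℓ m (mover root k t)⟩ = ρ ⟨t, e, h, ℓ⟩)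
    (hM : ∀ h : Path A root k j, ∑ m, w m * value u ρ (levelPair i ℓ m) n j ej h ≤ M) :
    ∀ (d t : ℕ) (e : t + (n + d) = k + 1) (h : Path A root k t),
      ∑ m, w m * value u ρ (levelPair i ℓ m) (n + d) t e h ≤ M
  | 0, t, e, h => by
    obtain rfl : t = j := by omega
    exact hM h
  | d + 1, t, e, h => by
    have ht : t ≤ k := by omega
    calc ∑ m, w m * value u ρ (levelPair i ℓ m) (n + d + 1) t e h
        = ∑ m, w m * ∑ a, ρ ⟨t, ht, h, ℓ⟩ a *
            value u ρ (levelPair i ℓ m) (n + d) (t + 1) (by omega) (h, a) := by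
          refine sum_congr rfl fun m _ => ?_
          simp only [value]
          rw [hρ t ht h m (by omega)]
      _ = ∑ a, ρ ⟨t, ht, h, ℓ⟩ a * ∑ m, w m *
            value u ρ (levelPair i ℓ m) (n + d) (t + 1) (by omega) (h, a) := by
          simp only [mul_sum]
          rw [sum_comm]
          exact sum_congr rfl fun a _ => sum_congr rfl fun m _ => by ring
      _ ≤ M := sum_mul_le _ fun a =>
          sum_mul_value_le u ρ i ℓ w n ej M hρ hM d (t + 1) (by omega) (h, a)

/-! ### The babbling profile -/

section Babbling

variable (r : Bool → (∀ j, A j) → ℝ) (π₀ : ∀ i, stdSimplex ℝ (A i))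
  (w : Bool → Fin (k + 1) → Fin (k + 1) → ℝ)

/-- A best reply of the player who chooses `a_{t+1}` to `a_t = a'`. -/
noncomputable def bestReply (root : Bool) (k t : ℕ) (a' : A (mover root k t)) :
    A (mover root k (t + 1)) :=
  have := nonempty_of_stdSimplex (π₀ (mover root k (t + 1)))
  argmax (pairPayoff r π₀ root k (mover root k (t + 1)) t a')

/-- The answer `a_{t+1}` of a player of level `m` to `a_t = a'`: the level-`0` policy at level `0`,
a best reply at all other levels. -/
noncomputable def reply (root : Bool) (t : ℕ) (m : Fin (k + 1)) (a' : A (mover root k t)) :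
    stdSimplex ℝ (A (mover root k (t + 1))) :=
  if m = 0 then π₀ _ else pureAction (bestReply r π₀ root k t a')

/-- The expected payoff from `a_t = a'`, if the answer to it is the last action, for the player who
chooses `a_t` at level `ℓ`; the levels of the opponent have the weights `w`. -/
noncomputable def commitmentPayoff (root : Bool) (t : ℕ) (ℓ : Fin (k + 1))
    (a' : A (mover root k t)) : ℝ :=
  ∑ m, w (mover root k t) ℓ m *
    ∑ a, reply r π₀ root t m a' a * pairPayoff r π₀ root k (mover root k t) t a' a

/-- A best choice of `a_t` for the player who anticipates the answer to it. -/
noncomputable def bestCommitment (root : Bool) (t : ℕ) (ℓ : Fin (k + 1)) : A (mover root k t) :=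
  have := nonempty_of_stdSimplex (π₀ (mover root k t))
  argmax (commitmentPayoff r π₀ w root t ℓ)

/-- The babbling profile: before the stage `k - 1`, all levels imitate the level-`0` policy; at the
stage `k - 1`, the levels other than `0` maximize the expected payoff with the weights `w` on the
levels of the opponent; at the stage `k`, they play a best reply to `a_{k-1}`. The level-`0` policy
of the stage `0` takes precedence over both. -/
noncomputable def babbling : Profile A root k
  | ⟨0, _, _, _⟩ => π₀ _
  | ⟨t + 1, _, h, ℓ⟩ =>
    if t + 1 = k then reply r π₀ root t ℓ h.2
    else if ℓ = 0 ∨ t + 3 ≤ k then π₀ _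
    else pureAction (bestCommitment r π₀ w root (t + 1) ℓ)

theorem babbling_respectsLevelZero :
    RespectsLevelZero π₀ (babbling r π₀ w : Profile A root k) := by
  rintro ⟨t, e, h, ℓ⟩ hI
  cases t with
  | zero => rfl
  | succ t =>
    obtain rfl : ℓ = 0 := by simpa using hI
    simp [babbling, reply]

theorem babbling_early {t : ℕ} (e : t ≤ k) (h : Path A root k t) (ℓ : Fin (k + 1))
    (ht : t + 2 ≤ k) :
    (babbling r π₀ w : Profile A root k) ⟨t, e, h, ℓ⟩ = π₀ _ := by
  cases t with
  | zero => rfl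
  | succ t =>
    unfold babbling
    simp only
    rw [if_neg (by omega), if_pos (Or.inr (by omega))]

theorem babbling_last {j : ℕ} (w : Bool → Fin (j + 1 + 1) → Fin (j + 1 + 1) → ℝ)
    (e : j + 1 ≤ j + 1) (h : Path A root (j + 1) j)
    (a' : A (mover root (j + 1) j)) (ℓ : Fin (j + 1 + 1)) :
    (babbling r π₀ w : Profile A root (j + 1)) ⟨j + 1, e, (h, a'), ℓ⟩ =
      reply r π₀ root j ℓ a' := by
  simp [babbling]

theorem babbling_penultimate {j : ℕ} (w : Bool → Fin (j + 1 + 1) → Fin (j + 1 + 1) → ℝ)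
    (e : j ≤ j + 1) (h : Path A root (j + 1) j) {ℓ : Fin (j + 1 + 1)} (hℓ : ℓ ≠ 0)
    (hj : j ≠ 0) :
    (babbling r π₀ w : Profile A root (j + 1)) ⟨j, e, h, ℓ⟩ =
      pureAction (bestCommitment r π₀ w root j ℓ) := by
  cases j with
  | zero => exact absurd rfl hj
  | succ j => simp [babbling, hℓ]

/-- At the stage `k - 1`, the babbling profile does not depend on the path. -/
theorem babbling_penultimate_congr {j : ℕ} (w : Bool → Fin (j + 1 + 1) → Fin (j + 1 + 1) → ℝ)
    (e : j ≤ j + 1) (h h' : Path A root (j + 1) j) (ℓ : Fin (j + 1 + 1)) :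
    (babbling r π₀ w : Profile A root (j + 1)) ⟨j, e, h, ℓ⟩ =
      (babbling r π₀ w : Profile A root (j + 1)) ⟨j, e, h', ℓ⟩ := by
  cases j with
  | zero => rfl
  | succ j => simp [babbling]

theorem sum_mul_pairPayoff_le_reply {t : ℕ} {ℓ : Fin (k + 1)} (hℓ : ℓ ≠ 0)
    (a' : A (mover root k t)) (x : stdSimplex ℝ (A (mover root k (t + 1)))) :
    ∑ a, x a * pairPayoff r π₀ root k (mover root k (t + 1)) t a' a ≤
      ∑ a, reply r π₀ root t ℓ a' a *
        pairPayoff r π₀ root k (mover root k (t + 1)) t a' a := by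
  rw [reply, if_neg hℓ, sum_pureAction_mul]
  have := nonempty_of_stdSimplex (π₀ (mover root k (t + 1)))
  exact sum_mul_le _ fun a => le_argmax _ a

theorem value_last {j : ℕ} (i : Bool) {ρ : Profile A root (j + 1)}
    {θ : Bool → Fin (j + 1 + 1)} {h : Path A root (j + 1) j} {a' : A (mover root (j + 1) j)}
    {y : stdSimplex ℝ (A (mover root (j + 1) (j + 1)))}
    (hy : ρ ⟨j + 1, le_rfl, (h, a'), θ (mover root (j + 1) (j + 1))⟩ = y)
    (e : j + 1 + 1 = j + 1 + 1) :
    value (payoff r π₀ i) ρ θ 1 (j + 1) e (h, a') =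
      ∑ a, y a * pairPayoff r π₀ root (j + 1) i j a' a := by
  subst hy
  simp only [value, ← payoff_eq_pairPayoff r π₀ i h a']

theorem value_penultimate {j : ℕ} (i : Bool) {ρ : Profile A root (j + 1)}
    {θ : Bool → Fin (j + 1 + 1)} {h : Path A root (j + 1) j}
    {x : stdSimplex ℝ (A (mover root (j + 1) j))}
    {y : A (mover root (j + 1) j) → stdSimplex ℝ (A (mover root (j + 1) (j + 1)))}
    (hx : ρ ⟨j, Nat.le_succ j, h, θ (mover root (j + 1) j)⟩ = x)
    (hy : ∀ a', ρ ⟨j + 1, le_rfl, (h, a'), θ (mover root (j + 1) (j + 1))⟩ = y a')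
    (e : j + 2 = j + 1 + 1) :
    value (payoff r π₀ i) ρ θ 2 j e h =
      ∑ a', x a' * ∑ a, y a' a * pairPayoff r π₀ root (j + 1) i j a' a := by
  subst hx
  exact sum_congr rfl fun a' _ =>
    congrArg _ (value_last r π₀ i (hy a') rfl)

/-- At the stage `k`, the level of the opponent is irrelevant, and the babbling profile is
optimal against each of them. -/
theorem value_last_le {j : ℕ} (w : Bool → Fin (j + 1 + 1) → Fin (j + 1 + 1) → ℝ)
    (τ : Profile A root (j + 1)) {ℓ : Fin (j + 1 + 1)} (hℓ : ℓ ≠ 0) (m : Fin (j + 1 + 1))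
    (e : j + 1 + 1 = j + 1 + 1) (h : Path A root (j + 1) (j + 1)) :
    value (payoff r π₀ (mover root (j + 1) (j + 1)))
        (deviate (mover root (j + 1) (j + 1)) τ (babbling r π₀ w))
        (levelPair (mover root (j + 1) (j + 1)) ℓ m) 1 (j + 1) e h ≤
      value (payoff r π₀ (mover root (j + 1) (j + 1))) (babbling r π₀ w)
        (levelPair (mover root (j + 1) (j + 1)) ℓ m) 1 (j + 1) e h := by
  obtain ⟨h, a'⟩ := h
  refine (value_last r π₀ _ (deviate_of_eq _ _ _ _ _ rfl) e).trans_le (le_of_le_of_eq ?_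
    (value_last r π₀ _ (babbling_last r π₀ w _ h a' _) e).symm)
  rw [levelPair_self]
  exact sum_mul_pairPayoff_le_reply r π₀ hℓ a' _

/-- From the stage `k - 1` on, no deviation at any path is better than the babbling profile at any
other path: neither the later actions of the opponent nor the weights depend on the path. -/
theorem value_penultimate_le {j : ℕ} (w : Bool → Fin (j + 1 + 1) → Fin (j + 1 + 1) → ℝ)
    (hw : ∀ i ℓ m, 0 ≤ w i ℓ m) {τ : Profile A root (j + 1)} (hτ : RespectsLevelZero π₀ τ)
    (i : Bool) {ℓ : Fin (j + 1 + 1)} (hℓ : ℓ ≠ 0) (e : j + 2 = j + 1 + 1)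
    (h h' : Path A root (j + 1) j) :
    ∑ m, w i ℓ m * value (payoff r π₀ i) (deviate i τ (babbling r π₀ w))
        (levelPair i ℓ m) 2 j e h ≤
      ∑ m, w i ℓ m * value (payoff r π₀ i) (babbling r π₀ w) (levelPair i ℓ m) 2 j e h' := by
  have hne := mover_succ_ne root (j + 1) j
  rcases eq_mover_or root (j + 1) j i with rfl | rfl
  · -- the player moves at the stage `j = k - 1` and faces the replies of the opponent
    have key : ∀ (ρ : Profile A root (j + 1)) (h : Path A root (j + 1) j),
        (∀ a' m, ρ ⟨j + 1, le_rfl, (h, a'), m⟩ = reply r π₀ root j m a') →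
        ∑ m, w (mover root (j + 1) j) ℓ m * value (payoff r π₀ (mover root (j + 1) j)) ρ
            (levelPair (mover root (j + 1) j) ℓ m) 2 j e h =
          ∑ a', ρ ⟨j, Nat.le_succ j, h, ℓ⟩ a' * commitmentPayoff r π₀ w root j ℓ a' := by
      intro ρ h hρ
      have hv : ∀ m, value (payoff r π₀ (mover root (j + 1) j)) ρ
          (levelPair (mover root (j + 1) j) ℓ m) 2 j e h =
          ∑ a', ρ ⟨j, Nat.le_succ j, h, ℓ⟩ a' * ∑ a, reply r π₀ root j m a' a *
            pairPayoff r π₀ root (j + 1) (mover root (j + 1) j) j a' a := fun m =>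
        value_penultimate r π₀ _ (by rw [levelPair_self])
          (fun a' => by rw [levelPair_of_ne hne]; exact hρ a' m) e
      simp only [hv, commitmentPayoff, mul_sum]
      rw [sum_comm]
      exact sum_congr rfl fun a' _ => sum_congr rfl fun m _ => sum_congr rfl fun a _ => by ring
    rw [key _ h fun a' m => (deviate_of_ne _ _ _ _ _ hne).trans (babbling_last r π₀ w _ h a' m),
      key _ h' fun a' m => babbling_last r π₀ w _ h' a' m, deviate_of_eq _ _ _ _ _ rfl]
    by_cases hj : j = 0
    · subst hj
      rw [hτ ⟨0, _, h, ℓ⟩ (Or.inl rfl)]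
      exact le_rfl
    · rw [babbling_penultimate r π₀ w _ h' hℓ hj, sum_pureAction_mul]
      have := nonempty_of_stdSimplex (π₀ (mover root (j + 1) j))
      exact sum_mul_le _ fun a => le_argmax (commitmentPayoff r π₀ w root j ℓ) a
  · -- the player moves at the stage `k` and observes an action that ignores the earlier path
    refine sum_le_sum fun m _ => mul_le_mul_of_nonneg_left ?_ (hw _ _ _)
    rw [value_penultimate r π₀ _
        ((deviate_of_ne _ _ _ _ _ hne.symm).trans (babbling_penultimate_congr r π₀ w _ h h' _))
        (fun a' => deviate_of_eq _ _ _ _ _ rfl) e,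
      value_penultimate r π₀ _ rfl (fun a' => babbling_last r π₀ w _ h' a' _) e, levelPair_self]
    exact sum_le_sum fun a' _ => mul_le_mul_of_nonneg_left
      (sum_mul_pairPayoff_le_reply r π₀ hℓ a' _) (stdSimplex.zero_le _ _)

/-- Before the stage `k`, no deviation is better than the babbling profile, if the levels of the
opponent keep the weights `w`. -/
theorem value_early_le (hw : ∀ i ℓ m, 0 ≤ w i ℓ m) {τ : Profile A root k}
    (hτ : RespectsLevelZero π₀ τ) (i : Bool) {ℓ : Fin (k + 1)} (hℓ : ℓ ≠ 0) (n t : ℕ)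
    (e : t + n = k + 1) (ht : t < k) (h : Path A root k t) :
    ∑ m, w i ℓ m * value (payoff r π₀ i) (deviate i τ (babbling r π₀ w))
        (levelPair i ℓ m) n t e h ≤
      ∑ m, w i ℓ m * value (payoff r π₀ i) (babbling r π₀ w) (levelPair i ℓ m) n t e h := by
  obtain ⟨j, rfl⟩ : ∃ j, k = j + 1 := ⟨k - 1, by omega⟩
  obtain ⟨d, rfl⟩ : ∃ d, n = 2 + d := ⟨n - 2, by omega⟩
  -- a path of stage `j` for the comparison; it exists because action sets are nonempty
  obtain ⟨h₀⟩ : Nonempty (Path A root (j + 1) j) := by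
    have hA : ∀ i, Nonempty (A i) := fun i => nonempty_of_stdSimplex (π₀ i)
    have : ∀ s, Nonempty (Path A root (j + 1) s) := by
      intro s
      induction s with
      | zero => exact ⟨PUnit.unit⟩
      | succ s ih => exact ⟨(ih.some, (hA _).some)⟩
    exact this j
  have hρ : ∀ ρ : Profile A root (j + 1), ∀ (t : ℕ) (e : t ≤ j + 1)
      (h : Path A root (j + 1) t) (m : Fin (j + 1 + 1)), t < j →
      deviate i ρ (babbling r π₀ w) ⟨t, e, h, levelPair i ℓ m (mover root (j + 1) t)⟩ =
        deviate i ρ (babbling r π₀ w) ⟨t, e, h, ℓ⟩ := by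
    intro ρ t e h m ht
    by_cases hm : mover root (j + 1) t = i
    · subst hm
      rw [levelPair_self]
    · rw [deviate_of_ne _ _ _ _ _ hm, deviate_of_ne _ _ _ _ _ hm,
        babbling_early r π₀ w _ _ _ (by omega),
        babbling_early r π₀ w _ _ _ (by omega)]
  have hσ := hρ (babbling r π₀ w)
  rw [deviate_self] at hσ
  refine (sum_mul_value_le (payoff r π₀ i) _ i ℓ (w i ℓ) 2 rfl _ (hρ τ)
    (fun h' => value_penultimate_le r π₀ w hw hτ i hℓ rfl h' h₀) d t e h).trans ?_
  -- the lower bound is the upper bound for the opposite weights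
  have := sum_mul_value_le (payoff r π₀ i) (babbling r π₀ w) i ℓ (fun m => -w i ℓ m) 2 rfl
    (-∑ m, w i ℓ m * value (payoff r π₀ i) (babbling r π₀ w) (levelPair i ℓ m) 2 j rfl h₀)
    hσ (fun h' => by
      have := value_penultimate_le r π₀ w hw (babbling_respectsLevelZero r π₀ w) i hℓ rfl h₀ h'
      rw [deviate_self] at this
      simpa only [neg_mul, sum_neg_distrib, neg_le_neg_iff] using this) d t e h
  simpa only [neg_mul, sum_neg_distrib, neg_le_neg_iff] using this

/-! ### Beliefs -/

/-- Before the stage `k`, the babbling profile reveals nothing about the levels. -/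
theorem reach_babbling_congr (θ θ' : Bool → Fin (k + 1)) : ∀ (t : ℕ) (e : t ≤ k + 1)
    (_ : t < k) (h : Path A root k t),
    reach (babbling r π₀ w) θ t e h = reach (babbling r π₀ w) θ' t e h
  | 0, _, _, _ => rfl
  | t + 1, e, ht, h => by
    simp only [reach]
    rw [reach_babbling_congr θ θ' t _ (by omega), babbling_early r π₀ w _ _ _ (by omega),
      babbling_early r π₀ w _ _ _ (by omega)]

end Babbling

theorem reach_nonneg (σ : Profile A root k) (θ : Bool → Fin (k + 1)) : ∀ (t : ℕ)
    (e : t ≤ k + 1) (h : Path A root k t), 0 ≤ reach σ θ t e h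
  | 0, _, _ => zero_le_one
  | t + 1, _, h => mul_nonneg (reach_nonneg σ θ t _ h.1) (stdSimplex.zero_le _ _)

open Classical in
/-- The beliefs given by Bayes' rule at the information sets that are reached with positive
probability, and equal to the prior at the others. -/
noncomputable def bayes (lam : Bool → Fin (k + 1) → stdSimplex ℝ (Fin (k + 1)))
    (σ : Profile A root k) : Beliefs A root k := fun I =>
  if hI : 0 < ∑ n, lam I.player I.level n * reachAt σ I n then
    ⟨fun m => lam I.player I.level m * reachAt σ I m /
        ∑ n, lam I.player I.level n * reachAt σ I n,
      fun m => div_nonneg (mul_nonneg (stdSimplex.zero_le _ _) (reach_nonneg _ _ _ _ _)) hI.le,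
      by rw [← sum_div, div_self hI.ne']⟩
  else lam I.player I.level

theorem bayes_of_pos (lam : Bool → Fin (k + 1) → stdSimplex ℝ (Fin (k + 1)))
    {σ : Profile A root k} {I : InfoSet A root k}
    (hI : 0 < ∑ n, lam I.player I.level n * reachAt σ I n) (m : Fin (k + 1)) :
    bayes lam σ I m = lam I.player I.level m * reachAt σ I m /
      ∑ n, lam I.player I.level n * reachAt σ I n := by
  rw [bayes, dif_pos hI]
  rfl

theorem consistent_bayes (lam : Bool → Fin (k + 1) → stdSimplex ℝ (Fin (k + 1)))
    (σ : Profile A root k) : Consistent lam σ (bayes lam σ) := by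
  refine fun I m => ⟨fun h0 => ?_, fun hI => bayes_of_pos lam hI m⟩
  by_cases hI : 0 < ∑ n, lam I.player I.level n * reachAt σ I n
  · rw [bayes_of_pos lam hI, h0, zero_mul, zero_div]
  · rw [bayes, dif_neg hI, h0]

theorem bayes_eq_prior (lam : Bool → Fin (k + 1) → stdSimplex ℝ (Fin (k + 1)))
    {σ : Profile A root k} {I : InfoSet A root k}
    (hσ : ∀ m n, reachAt σ I m = reachAt σ I n) : bayes lam σ I = lam I.player I.level := by
  by_cases hI : 0 < ∑ n, lam I.player I.level n * reachAt σ I n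
  · ext m
    rw [bayes_of_pos lam hI]
    have hs : ∑ n, lam I.player I.level n * reachAt σ I n = reachAt σ I m := by
      simp only [hσ _ m]
      rw [← sum_mul, stdSimplex.sum_eq_one, one_mul]
    rw [hs] at hI ⊢
    exact mul_div_cancel_right₀ _ hI.ne'
  · rw [bayes, dif_neg hI]

/-! ### Existence of equilibria -/

/-- For nonnegative weights `c`, the babbling profile that is optimal for the priors, weighted by
`c`, is a Perfect Bayesian Equilibrium. -/
theorem exists_isPBE (r : Bool → (∀ j, A j) → ℝ) (π₀ : ∀ i, stdSimplex ℝ (A i))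
    (lam : Bool → Fin (k + 1) → stdSimplex ℝ (Fin (k + 1)))
    (c : Bool → Fin (k + 1) → Fin (k + 1) → ℝ) (hc : ∀ i ℓ m, 0 ≤ c i ℓ m) :
    ∃ (σ : Profile A root k) (p : Beliefs A root k), IsPBE r π₀ lam c σ p := by
  set w : Bool → Fin (k + 1) → Fin (k + 1) → ℝ := fun i ℓ m => c i ℓ m * lam i ℓ m
  have hw : ∀ i ℓ m, 0 ≤ w i ℓ m := fun i ℓ m =>
    mul_nonneg (hc i ℓ m) (stdSimplex.zero_le _ _)
  have hr : RespectsLevelZero π₀ (babbling r π₀ w : Profile A root k) :=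
    babbling_respectsLevelZero r π₀ w
  refine ⟨babbling r π₀ w, bayes lam (babbling r π₀ w), hr, ?_, consistent_bayes _ _⟩
  intro I τ hτ
  by_cases h0 : I.stage = k ∧ I.stage = 0 ∨ I.level = 0
  · -- every action still to be chosen by this player is drawn from the level-`0` policy
    refine le_of_eq (sum_congr rfl fun m _ => ?_)
    congr 1
    refine value_congr _ (fun t e h => ?_) _ _ _ _
    by_cases hm : mover root k t = I.player
    · have hI : (⟨t, e, h, levelsAt I m (mover root k t)⟩ : InfoSet A root k).stage = 0 ∨
          (⟨t, e, h, levelsAt I m (mover root k t)⟩ : InfoSet A root k).level = 0 := by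
        rcases h0 with h0 | h0
        · left
          change t = 0
          omega
        · right
          simp [levelsAt, hm, h0]
      rw [deviate_of_eq _ _ _ _ _ hm, hτ _ hI, hr _ hI]
    · rw [deviate_of_ne _ _ _ _ _ hm]
  · push Not at h0
    obtain ⟨hk, hℓ⟩ := h0
    by_cases hI : I.stage = k
    · refine sum_le_sum fun m _ => mul_le_mul_of_nonneg_left ?_
        (mul_nonneg (hc _ _ _) (stdSimplex.zero_le _ _))
      obtain ⟨t, e, h, ℓ⟩ := I
      obtain ⟨j, rfl⟩ : ∃ j, t = j + 1 := ⟨t - 1, by have := hk hI; simp only at this; omega⟩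
      cases (show j + 1 = k from hI)
      unfold payoffAt
      generalize_proofs e'
      simp only at e' ⊢
      obtain ⟨n, hn⟩ : ∃ n, j + 1 + 1 - (j + 1) = n := ⟨_, rfl⟩
      revert e'
      rw [hn]
      obtain rfl : n = 1 := by omega
      intro e'
      exact value_last_le r π₀ w τ hℓ m e' h
    · have hlt : I.stage < k := lt_of_le_of_ne I.stage_le hI
      have hp : bayes lam (babbling r π₀ w) I = lam I.player I.level :=
        bayes_eq_prior lam fun m n => reach_babbling_congr r π₀ w _ _ _ _ hlt _
      rw [hp]
      exact value_early_le r π₀ w hw hτ I.player hℓ _ _ _ hlt I.path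

end GR2

theorem theorem1 {A : Bool → Type*} [∀ i, Fintype (A i)] (r : Bool → (∀ j, A j) → ℝ)
    (π₀ : ∀ i, stdSimplex ℝ (A i)) (root : Bool) (k : ℕ)
    (lam : Bool → Fin (k + 1) → stdSimplex ℝ (Fin (k + 1))) :
    (GR2.form A root k).IsFiniteForest ∧ (GR2.form A root k).PerfectRecall ∧
    (∃ (σ : GR2.Profile A root k) (p : GR2.Beliefs A root k),
      GR2.IsPBE r π₀ lam (fun _ _ _ => 1) σ p) ∧
    (∃ (σ : GR2.Profile A root k) (p : GR2.Beliefs A root k),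
      GR2.IsPBE r π₀ lam (fun i ℓ m => lam i ℓ m) σ p) :=
  ⟨GR2.form_isFiniteForest, GR2.form_perfectRecall,
    GR2.exists_isPBE r π₀ lam _ fun _ _ _ => zero_le_one,
    GR2.exists_isPBE r π₀ lam _ fun _ _ _ => stdSimplex.zero_le _ _⟩
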